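/- Fix a countably infinite set $\mathbb{A}$ of names, let $\mathrm{Perm}\,\mathbb{A}$ be the group of bijections of $\mathbb{A}$ fixing all but finitely many names, and for $S\subseteq\mathbb{A}$ let $\mathrm{Perm}_S\,\mathbb{A}$ be the subgroup fixing every $a\in S$. A *nominal set* is a set $X$ with a $\mathrm{Perm}\,\mathbb{A}$-action in which every $x$ has a finite support, i.e. a finite $S\subseteq\mathbb{A}$ with $\pi\cdot x=x$ for all $\pi\in\mathrm{Perm}_S\,\mathbb{A}$; $\mathrm{supp}\,x$ denotes the least such $S$. It is *orbit-finite* if it has finitely many orbits, and *strong* if $\pi\cdot x=x$ holds iff $\pi\in\mathrm{Perm}_{\mathrm{supp}\,x}\,\mathbb{A}$. A *nominal monoid* is a nominal set that is a monoid with equivariant multiplication and unit; morphisms are equivariant monoid morphisms, and a *nominal submonoid* is a submonoid closed under the action. A surjective morphism $e\colon M\twoheadrightarrow N$ is an *MSR quotient* if there is a nominal submonoid $M'\subseteq M$ such that $e|_{M'}\colon M'\to N$ is surjective and $\mathrm{supp}\,e(x)=\mathrm{supp}\,x$ for all $x\in M'$. An *MSR-pseudovariety* is a class of orbit-finite nominal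 monoids closed under finite products (including the empty one), nominal submonoids and MSR quotients. Let $\Sigma$ be an orbit-finite nominal set and $\Sigma^*$ the nominal monoid of finite words over it. A *support bound* is a map $s$ from $\Sigma^*$ to sets of names such that, for some $k\in\mathbb{N}$, $|s(w)|\le k$ for all $w$. A morphism $h\colon\Sigma^*\to M$ is *$s$-bounded* if $\mathrm{supp}\,h(w)\subseteq s(w)$ for all $w\in\Sigma^*$. The set $\widehat{\Sigma^*_s}$ of *$s$-bounded pro-orbit-finite words* is the set underlying the limit, taken in $k$-bounded nominal Stone spaces for any such $k$, of the codirected diagram of all $s$-bounded surjective morphisms $e\colon\Sigma^*\twoheadrightarrow M$ with $M$ an orbit-finite nominal monoid regarded as a discrete space, ordered by factorization; its elements are the compatible families $(x_e)_e$ with $x_e\in M$ having a common support of at most $k$ names. For an $s$-bounded morphism $h\colon\Sigma^*\to M$ with $M$ orbit-finite, let $h=m\circ e$ be its factorization into a surjective morphism $e$ and an injective morphism $m$, and put $\hat h(x)=m(x_e)$. An *explicit proequation* is a pair $x=y$ of elements of $\widehat{\Sigma^*_s}$, for some strong orbit-finite nominal set $\Sigma$ and some support bound $s$ on $\Sigma^*$.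 An orbit-finite nominal monoid $M$ *satisfies* it if $\hat h(x)=\hat h(y)$ for every $s$-bounded morphism $h\colon\Sigma^*\to M$. A class of orbit-finite nominal monoids is *presentable by explicit proequations* if it consists of exactly those orbit-finite nominal monoids that satisfy all members of some set of explicit proequations (over possibly different $\Sigma$ and $s$). **Theorem (Explicit Nominal Reiterman).** A class of orbit-finite nominal monoids is an MSR-pseudovariety if and only if it is presentable by explicit proequations. -/

import Mathlib

open MulAction

universe u

/-- The group `Perm 𝔸` of finite permutations: bijections `𝔸 → 𝔸` that fix all but finitely
many names. -/
def finPerm (𝔸 : Type u) : Subgroup (Equiv.Perm 𝔸) where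
  carrier := {π | {a | π a ≠ a}.Finite}
  one_mem' := by simp
  mul_mem' := by
    intro π σ hπ hσ
    refine (Set.Finite.union hπ hσ).subset ?_
    intro a ha
    by_contra hc
    simp only [Set.mem_union, Set.mem_ofPred_eq, not_or, not_not] at hc
    exact ha (by rw [Equiv.Perm.mul_apply, hc.2, hc.1])
  inv_mem' := by
    intro π hπ
    refine Set.Finite.subset hπ ?_
    intro a ha hc
    exact ha (by rw [Equiv.Perm.inv_eq_iff_eq, hc])

/-- Finite permutations of the names, as a group acting on the names. -/
abbrev FinPerm (𝔸 : Type u) : Type u := finPerm 𝔸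

section NominalSets

variable (𝔸 : Type u)

/-- A set with an action of the finite permutations is nominal if every element has a finite
support. -/
def IsNominal (X : Type u) [MulAction (FinPerm 𝔸) X] : Prop :=
  ∀ x : X, ∃ S : Finset 𝔸, Supports (FinPerm 𝔸) (S : Set 𝔸) x

/-- The support `supp x`: the intersection of all finite supports of `x`. In a nominal set over
an infinite set of names this is the least finite support of `x`. -/
def supp {X : Type u} [MulAction (FinPerm 𝔸) X] (x : X) : Set 𝔸 :=
  {a | ∀ S : Finset 𝔸, Supports (FinPerm 𝔸) (S : Set 𝔸) x → a ∈ S}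

/-- There are only finitely many orbits. -/
def IsOrbitFinite (X : Type u) [MulAction (FinPerm 𝔸) X] : Prop :=
  Finite (orbitRel.Quotient (FinPerm 𝔸) X)

/-- Strong nominal sets: `π • x = x` iff `π` fixes every name in `supp x`. -/
def IsStrong (X : Type u) [MulAction (FinPerm 𝔸) X] : Prop :=
  ∀ (x : X) (π : FinPerm 𝔸), π • x = x ↔ ∀ a ∈ supp 𝔸 x, π • a = a

end NominalSets

/-- Nominal monoids: the action is by monoid automorphisms, that is, multiplication and unit
are equivariant. -/
structure NominalMonoid (𝔸 : Type u) : Type (u + 1) where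
  carrier : Type u
  [monoid : Monoid carrier]
  [action : MulDistribMulAction (FinPerm 𝔸) carrier]
  nominal : IsNominal 𝔸 carrier

namespace NominalMonoid

variable {𝔸 : Type u}

instance : CoeSort (NominalMonoid 𝔸) (Type u) := ⟨carrier⟩

instance (M : NominalMonoid 𝔸) : Monoid M := M.monoid

instance (M : NominalMonoid 𝔸) : MulDistribMulAction (FinPerm 𝔸) M := M.action

/-- Orbit-finite nominal monoids. -/
def OrbitFinite (M : NominalMonoid 𝔸) : Prop := IsOrbitFinite 𝔸 M

/-- The product of finitely many nominal monoids, with componentwise structure. -/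
def pi {n : ℕ} (M : Fin n → NominalMonoid 𝔸) : NominalMonoid 𝔸 where
  carrier := ∀ i, M i
  nominal := by
    classical
    intro x
    choose S hS using fun i => (M i).nominal (x i)
    refine ⟨Finset.univ.biUnion S, fun π hπ => funext fun i => hS i π fun a ha => hπ ?_⟩
    exact Finset.mem_coe.2 (Finset.mem_biUnion.2 ⟨i, Finset.mem_univ i, ha⟩)

/-- Nominal submonoids: submonoids closed under the action. -/
structure NomSubmonoid (M : NominalMonoid 𝔸) extends Submonoid M where
  smul_mem' : ∀ (π : FinPerm 𝔸) {x : M}, x ∈ carrier → π • x ∈ carrier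

/-- A nominal submonoid as a nominal monoid, with the restricted structure. -/
def NomSubmonoid.toNominalMonoid {M : NominalMonoid 𝔸} (N : NomSubmonoid M) :
    NominalMonoid 𝔸 where
  carrier := N.toSubmonoid
  action :=
    { smul := fun π x => ⟨π • x.1, N.smul_mem' π x.2⟩
      one_smul := fun x => Subtype.ext (one_smul _ x.1)
      mul_smul := fun π σ x => Subtype.ext (mul_smul π σ x.1)
      smul_mul := fun π x y => Subtype.ext (smul_mul' π x.1 y.1)
      smul_one := fun π => Subtype.ext (smul_one π) }
  nominal := by
    intro x
    obtain ⟨S, hS⟩ := M.nominal x.1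
    exact ⟨S, fun π hπ => Subtype.ext (hS π hπ)⟩

end NominalMonoid

/-- `e : M → N` is an MSR (multiplicatively support-reflecting) quotient: it is surjective, and
there is a nominal submonoid `M'` of `M` such that the restriction of `e` to `M'` is surjective
onto `N` and support-preserving. -/
def IsMSRQuotient {𝔸 : Type u} {M N : NominalMonoid 𝔸} (e : M →*[FinPerm 𝔸] N) : Prop :=
  Function.Surjective e ∧
    ∃ M' : NominalMonoid.NomSubmonoid M,
      (∀ y : N, ∃ x ∈ M'.toSubmonoid, e x = y) ∧
      ∀ x ∈ M'.toSubmonoid, supp 𝔸 (e x) = supp 𝔸 x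

/-- MSR-pseudovarieties: classes of orbit-finite nominal monoids closed under finite products
(including the empty one), nominal submonoids, and MSR quotients. -/
structure IsMSRPseudovariety {𝔸 : Type u} (V : Set (NominalMonoid 𝔸)) : Prop where
  orbitFinite : ∀ M ∈ V, M.OrbitFinite
  prod_mem : ∀ (n : ℕ) (M : Fin n → NominalMonoid 𝔸),
    (∀ i, M i ∈ V) → NominalMonoid.pi M ∈ V
  sub_mem : ∀ M ∈ V, ∀ N : NominalMonoid.NomSubmonoid M, N.toNominalMonoid ∈ V
  quotient_mem : ∀ M ∈ V, ∀ (N : NominalMonoid 𝔸) (e : M →*[FinPerm 𝔸] N),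
    IsMSRQuotient e → N ∈ V

/-- The letterwise action on finite words. -/
instance FreeMonoid.letterwiseAction {G α : Type*} [Monoid G] [MulAction G α] :
    MulDistribMulAction G (FreeMonoid α) where
  smul g := FreeMonoid.map (g • ·)
  one_smul w := by
    change FreeMonoid.map (fun x => (1 : G) • x) w = w
    simp only [one_smul]
    exact DFunLike.congr_fun FreeMonoid.map_id w
  mul_smul g h w := by
    change FreeMonoid.map (fun x => (g * h) • x) w =
      FreeMonoid.map (fun x => g • x) (FreeMonoid.map (fun x => h • x) w)
    rw [FreeMonoid.map_map]
    simp only [mul_smul]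
    rfl
  smul_mul g v w := map_mul (FreeMonoid.map (g • ·)) v w
  smul_one g := map_one (FreeMonoid.map (g • ·))

/-- Support bounds: maps assigning to each word over `Sig` a set of at most `k` names, for some
`k` independent of the word. No equivariance is required. -/
structure SupportBound (𝔸 Sig : Type u) : Type u where
  toFun : FreeMonoid Sig → Finset 𝔸
  bounded : ∃ k : ℕ, ∀ w, (toFun w).card ≤ k

/-- A map `h` on words is `s`-bounded if `supp h(w) ⊆ s(w)` for all words `w`. -/
def SupportBound.Bounds {𝔸 Sig : Type u} (s : SupportBound 𝔸 Sig) {X : Type u}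
    [MulAction (FinPerm 𝔸) X] (h : FreeMonoid Sig → X) : Prop :=
  ∀ w, supp 𝔸 (h w) ⊆ (s.toFun w : Set 𝔸)

section Words

variable {𝔸 Sig : Type u} [MulAction (FinPerm 𝔸) Sig]

/-- Equivariant congruences on the free monoid; they represent the quotients of the free monoid
in the category of nominal monoids. -/
structure EquivariantCon (𝔸 Sig : Type u) [MulAction (FinPerm 𝔸) Sig] : Type u where
  con : Con (FreeMonoid Sig)
  smul_con : ∀ (π : FinPerm 𝔸) {v w : FreeMonoid Sig}, con v w → con (π • v) (π • w)

namespace EquivariantCon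

/-- The quotient of the free monoid by an equivariant congruence. -/
def Quot (c : EquivariantCon 𝔸 Sig) : Type u := c.con.Quotient

instance (c : EquivariantCon 𝔸 Sig) : Monoid c.Quot := inferInstanceAs (Monoid c.con.Quotient)

/-- The projection to the quotient. -/
def proj (c : EquivariantCon 𝔸 Sig) : FreeMonoid Sig →* c.Quot := c.con.mk'

theorem proj_surjective (c : EquivariantCon 𝔸 Sig) : Function.Surjective c.proj :=
  Con.mk'_surjective

theorem proj_eq (c : EquivariantCon 𝔸 Sig) {v w : FreeMonoid Sig} :
    c.proj v = c.proj w ↔ c.con v w := c.con.eq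

/-- The action on the quotient making the projection equivariant. -/
instance (c : EquivariantCon 𝔸 Sig) : SMul (FinPerm 𝔸) c.Quot where
  smul π := Quotient.map' (s₁ := c.con.toSetoid) (s₂ := c.con.toSetoid) (π • ·)
    fun _ _ h => c.smul_con π h

theorem smul_proj (c : EquivariantCon 𝔸 Sig) (π : FinPerm 𝔸) (w : FreeMonoid Sig) :
    π • c.proj w = c.proj (π • w) := rfl

instance (c : EquivariantCon 𝔸 Sig) : MulDistribMulAction (FinPerm 𝔸) c.Quot where
  one_smul x := by
    obtain ⟨w, rfl⟩ := c.proj_surjective x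
    rw [smul_proj, one_smul]
  mul_smul π σ x := by
    obtain ⟨w, rfl⟩ := c.proj_surjective x
    rw [smul_proj, smul_proj, smul_proj, mul_smul]
  smul_mul π x y := by
    obtain ⟨v, rfl⟩ := c.proj_surjective x
    obtain ⟨w, rfl⟩ := c.proj_surjective y
    rw [← map_mul, smul_proj, smul_proj, smul_proj, smul_mul', map_mul]
  smul_one π := by
    rw [← map_one c.proj, smul_proj, smul_one]

/-- For `c ≤ d` in the order of congruences, the induced morphism between the quotients. -/
def map (c d : EquivariantCon 𝔸 Sig) (h : c.con ≤ d.con) : c.Quot →* d.Quot :=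
  Con.map c.con d.con h

/-- The kernel congruence of an equivariant monoid morphism. -/
def ker {M : NominalMonoid 𝔸} (h : FreeMonoid Sig →*[FinPerm 𝔸] M) :
    EquivariantCon 𝔸 Sig where
  con := Con.ker h.toMonoidHom
  smul_con π v w hvw := by
    change h (π • v) = h (π • w)
    rw [map_smul, map_smul, show h v = h w from hvw]

/-- The injective morphism from the quotient by the kernel of `h` to the codomain of `h`. It
identifies the quotient by the kernel with the image of `h`. -/
def kerLift {M : NominalMonoid 𝔸} (h : FreeMonoid Sig →*[FinPerm 𝔸] M) :
    (ker h).Quot →* M :=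
  Con.kerLift h.toMonoidHom

theorem kerLift_proj {M : NominalMonoid 𝔸} (h : FreeMonoid Sig →*[FinPerm 𝔸] M)
    (w : FreeMonoid Sig) : kerLift h ((ker h).proj w) = h w := rfl

theorem kerLift_injective {M : NominalMonoid 𝔸} (h : FreeMonoid Sig →*[FinPerm 𝔸] M) :
    Function.Injective (kerLift h) :=
  Con.kerLift_injective h.toMonoidHom

theorem kerLift_smul {M : NominalMonoid 𝔸} (h : FreeMonoid Sig →*[FinPerm 𝔸] M)
    (π : FinPerm 𝔸) (x : (ker h).Quot) : kerLift h (π • x) = π • kerLift h x := by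
  obtain ⟨w, rfl⟩ := (ker h).proj_surjective x
  rw [smul_proj, kerLift_proj, kerLift_proj, map_smul]

end EquivariantCon

/-- The `s`-bounded orbit-finite quotient monoids of the free monoid. -/
structure BoundedQuotient (s : SupportBound 𝔸 Sig) extends EquivariantCon 𝔸 Sig where
  orbitFinite : IsOrbitFinite 𝔸 toEquivariantCon.Quot
  bounded : s.Bounds toEquivariantCon.proj

/-- The coimage of an `s`-bounded equivariant morphism into an orbit-finite nominal monoid, as
an `s`-bounded orbit-finite quotient monoid. -/
def BoundedQuotient.coimage {s : SupportBound 𝔸 Sig} {M : NominalMonoid 𝔸}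
    (hM : M.OrbitFinite) (h : FreeMonoid Sig →*[FinPerm 𝔸] M) (hs : s.Bounds h) :
    BoundedQuotient s where
  toEquivariantCon := EquivariantCon.ker h
  orbitFinite := by
    have : Finite (orbitRel.Quotient (FinPerm 𝔸) M) := hM
    let f : orbitRel.Quotient (FinPerm 𝔸) (EquivariantCon.ker h).Quot →
        orbitRel.Quotient (FinPerm 𝔸) M :=
      Quotient.map' (EquivariantCon.kerLift h) (by
        rintro _ y ⟨π, rfl⟩
        exact ⟨π, (EquivariantCon.kerLift_smul h π y).symm⟩)
    refine Finite.of_injective f ?_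
    intro a b
    induction a using Quotient.inductionOn'
    induction b using Quotient.inductionOn'
    intro hab
    obtain ⟨π, hπ⟩ := Quotient.exact' hab
    refine Quotient.sound' ⟨π, EquivariantCon.kerLift_injective h ?_⟩
    rw [EquivariantCon.kerLift_smul]
    exact hπ
  bounded := by
    intro w a ha
    refine hs w fun S hS => ha S fun π hπ => ?_
    apply EquivariantCon.kerLift_injective h
    rw [EquivariantCon.kerLift_smul, EquivariantCon.kerLift_proj]
    exact hS π hπ

/-- The `s`-bounded pro-orbit-finite words over `Sig`: the elements of the limit, over all
`s`-bounded orbit-finite quotient monoids of the free monoid (ordered by factorization), of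
their underlying nominal sets. The limit of this diagram of `k`-bounded nominal sets consists of
the compatible families that have a support of at most `k` names, where `k` bounds the size of
the sets `s(w)`. (The topology of the limit plays no role for its elements and projections.) -/
structure ProWord (s : SupportBound 𝔸 Sig) : Type u where
  val : ∀ q : BoundedQuotient s, q.Quot
  compatible : ∀ (q r : BoundedQuotient s) (h : q.con ≤ r.con),
    EquivariantCon.map q.toEquivariantCon r.toEquivariantCon h (val q) = val r
  supported : ∀ k : ℕ, (∀ w, (s.toFun w).card ≤ k) →
    ∃ S : Finset 𝔸, S.card ≤ k ∧
      ∀ q : BoundedQuotient s, Supports (FinPerm 𝔸) (S : Set 𝔸) (val q)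

/-- The map `ĥ` from pro-orbit-finite words to `M` associated to an `s`-bounded equivariant
morphism `h` into an orbit-finite nominal monoid `M`: the limit projection of the coimage of `h`,
followed by the inclusion of the image of `h` into `M`. -/
def ProWord.hat {s : SupportBound 𝔸 Sig} {M : NominalMonoid 𝔸}
    (hM : M.OrbitFinite) (h : FreeMonoid Sig →*[FinPerm 𝔸] M) (hs : s.Bounds h)
    (x : ProWord s) : M :=
  EquivariantCon.kerLift h (x.val (BoundedQuotient.coimage hM h hs))

end Words

/-- Explicit proequations `x = y`: pairs of `s`-bounded pro-orbit-finite words over a strong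
orbit-finite nominal set, for some support bound `s`. -/
structure ExplicitProequation (𝔸 : Type u) : Type (u + 1) where
  Sig : Type u
  [action : MulAction (FinPerm 𝔸) Sig]
  nominal : IsNominal 𝔸 Sig
  orbitFinite : IsOrbitFinite 𝔸 Sig
  strong : IsStrong 𝔸 Sig
  s : SupportBound 𝔸 Sig
  lhs : ProWord s
  rhs : ProWord s

attribute [instance] ExplicitProequation.action

/-- An orbit-finite nominal monoid satisfies `x = y` if `ĥ(x) = ĥ(y)` for all `s`-bounded
equivariant monoid morphisms `h`. -/
def ExplicitProequation.SatisfiedBy {𝔸 : Type u} (E : ExplicitProequation 𝔸)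
    (M : NominalMonoid 𝔸) (hM : M.OrbitFinite) : Prop :=
  ∀ (h : FreeMonoid E.Sig →*[FinPerm 𝔸] M) (hs : E.s.Bounds h),
    E.lhs.hat hM h hs = E.rhs.hat hM h hs

/-- `V` is the class of all orbit-finite nominal monoids that satisfy every proequation of some
set of explicit proequations, possibly over different alphabets and support bounds. Smallness
says that this is a set of proequations rather than a proper class. -/
def IsPresentableByExplicitProequations {𝔸 : Type u} (V : Set (NominalMonoid 𝔸)) : Prop :=
  ∃ T : Set (ExplicitProequation 𝔸), Small.{u} T ∧
    V = {M | ∃ hM : M.OrbitFinite, ∀ E ∈ T, E.SatisfiedBy M hM}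

/-! Soundness. Satisfaction passes to products and submonoids because `ProWord.hat` commutes with
composition (`ProWord.hat_comp`). For an MSR quotient `e : M → N` with witness `M'`, an `s`-bounded
`h` into `N` lifts to `M`: over a strong alphabet, preimages of the letters can be chosen in `M'`
equivariantly (`IsStrong.exists_equivariant`), and since `e` preserves supports on `M'`, the lift is
bounded by the same `s`.

Completeness. Take all proequations over tuple alphabets that hold throughout `V`, and let `M`
satisfy them. Cover `M` by a surjection `g` from words over tuples, with `s(w) = supp g(w)`. If some
`s`-bounded quotient in `V` refines `g`, the induced map onto `M` preserves supports, so it is an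
MSR quotient and `M ∈ V` (`mem_of_refinement`). Otherwise every `s`-bounded quotient in `V`
identifies two words that `g` separates, and a limit of these pairs gives two pro-words that agree
at all quotients in `V` but differ at `g` (`exists_separating`), which contradicts the choice of
`M`.

The limits exist by compactness (`ProWord.exists_limit`): bounded supports can be renamed into one
fixed finite window of names, and an orbit-finite nominal set has only finitely many elements
supported by that window. -/

/-! ### Finite permutations of names -/

namespace FinPerm

variable {𝔸 : Type u}

open Classical in
/-- Transpositions as finite permutations. -/
noncomputable def swap (a b : 𝔸) : FinPerm 𝔸 :=
  ⟨Equiv.swap a b, (Set.toFinite {a, b}).subset fun c hc => by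
    by_contra h
    simp only [Set.mem_insert_iff, Set.mem_singleton_iff, not_or] at h
    exact hc (Equiv.swap_apply_of_ne_of_ne h.1 h.2)⟩

theorem swap_smul_left (a b : 𝔸) : swap a b • a = b := by
  classical exact Equiv.swap_apply_left a b

theorem swap_smul_right (a b : 𝔸) : swap a b • b = a := by
  classical exact Equiv.swap_apply_right a b

theorem swap_smul_of_ne {a b c : 𝔸} (ha : c ≠ a) (hb : c ≠ b) : swap a b • c = c := by
  classical exact Equiv.swap_apply_of_ne_of_ne ha hb

/-- Reduces an arbitrary transposition to transpositions with a fresh name `c`, as needed for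
intersecting supports. -/
theorem swap_conj {a b c : 𝔸} (hab : a ≠ b) (hca : c ≠ a) (hcb : c ≠ b) :
    swap a c * swap b c * swap a c = swap a b := by
  refine Subtype.ext (Equiv.ext fun d => ?_)
  change swap a c • swap b c • swap a c • d = swap a b • d
  by_cases h1 : d = a
  · subst h1
    rw [swap_smul_left, swap_smul_left, swap_smul_right, swap_smul_of_ne hab.symm hcb.symm]
  by_cases h2 : d = b
  · subst h2
    rw [swap_smul_right, swap_smul_of_ne h1 hcb.symm, swap_smul_left, swap_smul_right]
  by_cases h3 : d = c
  · subst h3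
    rw [swap_smul_right, swap_smul_of_ne hab hca.symm, swap_smul_left, swap_smul_of_ne h1 h2]
  rw [swap_smul_of_ne h1 h3, swap_smul_of_ne h2 h3, swap_smul_of_ne h1 h3,
    swap_smul_of_ne h1 h2]

/-- A subgroup that contains all transpositions of names outside `C` contains all finite
permutations that fix `C` pointwise. -/
theorem mem_of_swap_mem (H : Subgroup (FinPerm 𝔸)) (C : Set 𝔸)
    (hH : ∀ a b, a ∉ C → b ∉ C → swap a b ∈ H) (π : FinPerm 𝔸) (hπ : ∀ a ∈ C, π • a = a) :
    π ∈ H := by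
  induction hn : {a : 𝔸 | π • a ≠ a}.ncard using Nat.strong_induction_on generalizing π with
  | _ n ih =>
    by_cases h : ∃ a : 𝔸, π • a ≠ a
    · obtain ⟨a, ha⟩ := h
      have haC : a ∉ C := fun h => ha (hπ a h)
      have hbC : π • a ∉ C := fun h => ha (smul_left_cancel π (hπ _ h))
      -- Composing with this swap moves no new name and fixes `a`, so the number of moved names
      -- drops.
      have hσ : ∀ b : 𝔸, π • b = b → (swap a (π • a) * π) • b = b := by
        intro b hb
        rw [mul_smul, hb]
        refine swap_smul_of_ne ?_ ?_
        · rintro rfl; exact ha hb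
        · rintro rfl; exact ha (smul_left_cancel π hb)
      have hlt : {b : 𝔸 | (swap a (π • a) * π) • b ≠ b}.ncard < n := by
        rw [← hn]
        refine Set.ncard_lt_ncard ⟨fun b hb hb' => hb (hσ b hb'), fun hsub => ?_⟩ π.2
        exact hsub (show a ∈ {b : 𝔸 | π • b ≠ b} from ha) (by rw [mul_smul, swap_smul_right])
      have hmem := ih _ hlt (swap a (π • a) * π) (fun b hb => hσ b (hπ b hb)) rfl
      exact (H.mul_mem_cancel_left (hH _ _ haC hbC)).1 hmem
    · push Not at h
      have : π = 1 := Subtype.ext (Equiv.ext h)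
      rw [this]
      exact H.one_mem

/-- The finite permutations act transitively on tuples of distinct names. -/
theorem exists_smul_embedding_eq {k : ℕ} (t t' : Fin k ↪ 𝔸) : ∃ π : FinPerm 𝔸, π • t = t' := by
  induction k with
  | zero => exact ⟨1, Function.Embedding.ext fun i => i.elim0⟩
  | succ k ih =>
    obtain ⟨π, hπ⟩ := ih (Fin.castSuccEmb.trans t)
      (Fin.castSuccEmb.trans t')
    have hi : ∀ i : Fin k, π • t i.castSucc = t' i.castSucc := fun i => DFunLike.congr_fun hπ i
    -- Only the last entry remains to be corrected; injectivity of both tuples keeps the entries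
    -- already placed away from the swap.
    refine ⟨swap (π • t (Fin.last k)) (t' (Fin.last k)) * π, Function.Embedding.ext fun i => ?_⟩
    rw [Function.Embedding.smul_apply, mul_smul]
    induction i using Fin.lastCases with
    | last => rw [swap_smul_left]
    | cast i =>
      rw [hi]
      refine swap_smul_of_ne ?_ fun h => (Fin.castSucc_lt_last i).ne (t'.injective h)
      rw [← hi]
      exact fun h => (Fin.castSucc_lt_last i).ne (t.injective (smul_left_cancel π h))

/-- Padding `A` to exactly `k` names reduces this to transitivity on tuples. It provides the fixed
window into which all small supports can be renamed. -/
theorem exists_smul_mem_range [Infinite 𝔸] {k : ℕ} (t : Fin k ↪ 𝔸) (A : Finset 𝔸)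
    (hA : A.card ≤ k) : ∃ π : FinPerm 𝔸, ∀ a ∈ A, π • a ∈ Set.range t := by
  obtain ⟨B, hAB, hB⟩ := Infinite.exists_superset_card_eq A k hA
  obtain ⟨π, hπ⟩ := exists_smul_embedding_eq
    ((B.equivFinOfCardEq hB).symm.toEmbedding.trans (Function.Embedding.subtype _)) t
  refine ⟨π, fun a ha => ⟨B.equivFinOfCardEq hB ⟨a, hAB ha⟩, ?_⟩⟩
  rw [← hπ]
  simp

end FinPerm

/-! ### Supports and orbit-finiteness -/

section Support

variable {𝔸 : Type u} {X Y : Type u} [MulAction (FinPerm 𝔸) X] [MulAction (FinPerm 𝔸) Y]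

theorem MulAction.Supports.smul_eq_smul {S : Set 𝔸} {x : X} (hS : Supports (FinPerm 𝔸) S x)
    {π σ : FinPerm 𝔸} (h : ∀ a ∈ S, π • a = σ • a) : π • x = σ • x := by
  rw [← inv_smul_eq_iff, ← mul_smul]
  exact hS _ fun a ha => by rw [mul_smul, inv_smul_eq_iff, h a ha]

theorem MulAction.Supports.inter [Infinite 𝔸] {S T : Finset 𝔸} {x : X}
    (hS : Supports (FinPerm 𝔸) (S : Set 𝔸) x) (hT : Supports (FinPerm 𝔸) (T : Set 𝔸) x) :
    Supports (FinPerm 𝔸) ((S : Set 𝔸) ∩ T) x := by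
  classical
  intro π hπ
  refine FinPerm.mem_of_swap_mem (stabilizer (FinPerm 𝔸) x) _ (fun a b ha hb => ?_) π hπ
  by_cases hab : a = b
  · subst hab
    have : FinPerm.swap a a = 1 := Subtype.ext (Equiv.swap_self a)
    rw [this]
    exact one_mem _
  obtain ⟨c, hc⟩ := Infinite.exists_notMem_finset (S ∪ T ∪ {a, b})
  simp only [Finset.mem_union, Finset.mem_insert, Finset.mem_singleton, not_or] at hc
  -- The name `c` is outside both supports and `d` is outside at least one of them, so that one is
  -- untouched by the swap.
  have key : ∀ d, d ∉ (S : Set 𝔸) ∩ T → FinPerm.swap d c ∈ stabilizer (FinPerm 𝔸) x := by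
    intro d hd
    by_cases hdS : d ∈ S
    · refine hT _ fun e he => FinPerm.swap_smul_of_ne ?_ ?_
      · rintro rfl; exact hd ⟨hdS, he⟩
      · rintro rfl; exact hc.1.2 he
    · refine hS _ fun e he => FinPerm.swap_smul_of_ne ?_ ?_
      · rintro rfl; exact hdS he
      · rintro rfl; exact hc.1.1 he
  rw [← FinPerm.swap_conj hab hc.2.1 hc.2.2]
  exact mul_mem (mul_mem (key a ha) (key b hb)) (key a ha)

theorem supp_subset {S : Finset 𝔸} {x : X} (hS : Supports (FinPerm 𝔸) (S : Set 𝔸) x) :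
    supp 𝔸 x ⊆ S := fun _ ha => ha S hS

/-- Supports are closed under intersection, so a minimal finite support is the least one. -/
theorem exists_finset_coe_eq_supp [Infinite 𝔸] {x : X}
    (hx : ∃ S : Finset 𝔸, Supports (FinPerm 𝔸) (S : Set 𝔸) x) :
    ∃ S : Finset 𝔸, (S : Set 𝔸) = supp 𝔸 x ∧ Supports (FinPerm 𝔸) (S : Set 𝔸) x := by
  classical
  obtain ⟨S, hS, hmin⟩ := exists_minimal_of_wellFoundedLT
    (fun S : Finset 𝔸 => Supports (FinPerm 𝔸) (S : Set 𝔸) x) hx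
  refine ⟨S, Set.Subset.antisymm (fun a ha T hT => ?_) (supp_subset hS), hS⟩
  have h : Supports (FinPerm 𝔸) ((S ∩ T : Finset 𝔸) : Set 𝔸) x := by
    rw [Finset.coe_inter]; exact hS.inter hT
  exact (Finset.mem_inter.1 (hmin h Finset.inter_subset_left ha)).2

theorem IsNominal.finite_supp (hX : IsNominal 𝔸 X) (x : X) : (supp 𝔸 x).Finite := by
  obtain ⟨S, hS⟩ := hX x
  exact S.finite_toSet.subset (supp_subset hS)

theorem IsNominal.supports_supp [Infinite 𝔸] (hX : IsNominal 𝔸 X) (x : X) :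
    Supports (FinPerm 𝔸) (supp 𝔸 x) x := by
  obtain ⟨S, hS, h⟩ := exists_finset_coe_eq_supp (hX x)
  rwa [← hS]

theorem supports_map {f : X → Y} (hf : ∀ (π : FinPerm 𝔸) x, f (π • x) = π • f x) {S : Set 𝔸}
    {x : X} (hS : Supports (FinPerm 𝔸) S x) : Supports (FinPerm 𝔸) S (f x) :=
  fun π hπ => by rw [← hf, hS π hπ]

theorem supp_map_subset {f : X → Y} (hf : ∀ (π : FinPerm 𝔸) x, f (π • x) = π • f x) (x : X) :
    supp 𝔸 (f x) ⊆ supp 𝔸 x := fun _ ha S hS => ha S (supports_map hf hS)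

theorem supp_map_of_injective {f : X → Y} (hf : ∀ (π : FinPerm 𝔸) x, f (π • x) = π • f x)
    (hinj : Function.Injective f) (x : X) : supp 𝔸 (f x) = supp 𝔸 x := by
  refine (supp_map_subset hf x).antisymm fun a ha S hS => ha S fun π hπ => hinj ?_
  rw [hf, hS π hπ]

theorem supports_smul {S : Set 𝔸} {x : X} (hS : Supports (FinPerm 𝔸) S x) (π : FinPerm 𝔸) :
    Supports (FinPerm 𝔸) ((π • ·) '' S) (π • x) := by
  intro σ hσ
  rw [← mul_smul]
  exact hS.smul_eq_smul fun a ha => by rw [mul_smul]; exact hσ ⟨a, ha, rfl⟩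

theorem smul_mem_supp {a : 𝔸} {x : X} (ha : a ∈ supp 𝔸 x) (π : FinPerm 𝔸) :
    π • a ∈ supp 𝔸 (π • x) := by
  classical
  intro S hS
  have h := supports_smul hS π⁻¹
  rw [inv_smul_smul] at h
  obtain ⟨b, hb, rfl⟩ : a ∈ (π⁻¹ • ·) '' (S : Set 𝔸) := by
    have := ha (S.image (π⁻¹ • ·)) (by rwa [Finset.coe_image])
    rwa [← Finset.mem_coe, Finset.coe_image] at this
  rwa [smul_inv_smul]

theorem supp_smul (π : FinPerm 𝔸) (x : X) : supp 𝔸 (π • x) = (π • ·) '' supp 𝔸 x := by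
  refine Set.Subset.antisymm (fun a ha => ⟨π⁻¹ • a, ?_, smul_inv_smul π a⟩) ?_
  · simpa using smul_mem_supp ha π⁻¹
  · rintro _ ⟨a, ha, rfl⟩
    exact smul_mem_supp ha π

theorem ncard_supp_smul (π : FinPerm 𝔸) (x : X) : (supp 𝔸 (π • x)).ncard = (supp 𝔸 x).ncard := by
  rw [supp_smul]
  exact Set.ncard_image_of_injective _ (MulAction.injective π)

/-- If a support `T` missed some `a ∈ S`, swapping `a` with a fresh name would fix `x` and yet move
`a`. -/
theorem supp_eq_of_supports_of_forall_fix [Infinite 𝔸] {S : Finset 𝔸} {x : X}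
    (hS : Supports (FinPerm 𝔸) (S : Set 𝔸) x)
    (h : ∀ π : FinPerm 𝔸, π • x = x → ∀ a ∈ S, π • a = a) : supp 𝔸 x = S := by
  classical
  refine (supp_subset hS).antisymm fun a ha T hT => ?_
  by_contra haT
  obtain ⟨b, hb⟩ := Infinite.exists_notMem_finset (insert a T)
  rw [Finset.mem_insert, not_or] at hb
  have hfix : FinPerm.swap a b • x = x := hT _ fun c hc => FinPerm.swap_smul_of_ne
    (fun h => haT (h ▸ hc)) (fun h => hb.2 (h ▸ hc))
  have := h _ hfix a ha
  rw [FinPerm.swap_smul_left] at this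
  exact hb.1 this

/-- An orbit-finite set is covered by the orbits of finitely many representatives. -/
theorem IsOrbitFinite.exists_representatives (hX : IsOrbitFinite 𝔸 X) :
    ∃ (n : ℕ) (r : Fin n → X), ∀ x, ∃ i, ∃ π : FinPerm 𝔸, π • r i = x := by
  have : Finite (orbitRel.Quotient (FinPerm 𝔸) X) := hX
  obtain ⟨n, ⟨f⟩⟩ := Finite.exists_equiv_fin (orbitRel.Quotient (FinPerm 𝔸) X)
  refine ⟨n, fun i => (f.symm i).out, fun x => ⟨f ⟦x⟧, ?_⟩⟩
  dsimp only
  rw [Equiv.symm_apply_apply]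
  exact (orbitRel (FinPerm 𝔸) X).symm (Quotient.mk_out (s := orbitRel (FinPerm 𝔸) X) x)

theorem isOrbitFinite_of_representatives {ι : Type*} [Finite ι] (r : ι → X)
    (hr : ∀ x, ∃ i, ∃ π : FinPerm 𝔸, π • r i = x) : IsOrbitFinite 𝔸 X := by
  refine Finite.of_surjective (fun i => (⟦r i⟧ : orbitRel.Quotient (FinPerm 𝔸) X)) fun q => ?_
  induction q using Quotient.inductionOn with
  | _ x =>
    obtain ⟨i, π, rfl⟩ := hr x
    exact ⟨i, Quotient.sound ((orbitRel (FinPerm 𝔸) X).symm ⟨π, rfl⟩)⟩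

theorem IsOrbitFinite.of_injective (hY : IsOrbitFinite 𝔸 Y) {f : X → Y}
    (hf : ∀ (π : FinPerm 𝔸) x, f (π • x) = π • f x) (hinj : Function.Injective f) :
    IsOrbitFinite 𝔸 X := by
  classical
  obtain ⟨n, r, hr⟩ := hY.exists_representatives
  let I := {i : Fin n // ∃ x : X, ∃ π : FinPerm 𝔸, π • r i = f x}
  choose g hg using fun i : I => i.2
  refine isOrbitFinite_of_representatives g fun x => ?_
  obtain ⟨i, π, hπ⟩ := hr (f x)
  obtain ⟨σ, hσ⟩ := hg ⟨i, x, π, hπ⟩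
  refine ⟨⟨i, x, π, hπ⟩, π * σ⁻¹, hinj ?_⟩
  rw [hf, ← hσ, mul_smul, inv_smul_smul, hπ]

theorem IsOrbitFinite.of_surjective (hX : IsOrbitFinite 𝔸 X) {f : X → Y}
    (hf : ∀ (π : FinPerm 𝔸) x, f (π • x) = π • f x) (hsurj : Function.Surjective f) :
    IsOrbitFinite 𝔸 Y := by
  obtain ⟨n, r, hr⟩ := hX.exists_representatives
  refine isOrbitFinite_of_representatives (fun i => f (r i)) fun y => ?_
  obtain ⟨x, rfl⟩ := hsurj y
  obtain ⟨i, π, rfl⟩ := hr x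
  exact ⟨i, π, (hf _ _).symm⟩

theorem IsOrbitFinite.exists_ncard_supp_le (hX : IsOrbitFinite 𝔸 X) :
    ∃ k, ∀ x : X, (supp 𝔸 x).ncard ≤ k := by
  obtain ⟨n, r, hr⟩ := hX.exists_representatives
  refine ⟨Finset.univ.sup fun i => (supp 𝔸 (r i)).ncard, fun x => ?_⟩
  obtain ⟨i, π, rfl⟩ := hr x
  rw [ncard_supp_smul]
  exact Finset.le_sup (f := fun i => (supp 𝔸 (r i)).ncard) (Finset.mem_univ i)

/-- An orbit-finite nominal set has finitely many elements with a given finite support. -/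
theorem IsOrbitFinite.finite_supports [Infinite 𝔸] (hX : IsOrbitFinite 𝔸 X)
    (hnom : IsNominal 𝔸 X) (S : Finset 𝔸) :
    {x : X | Supports (FinPerm 𝔸) (S : Set 𝔸) x}.Finite := by
  obtain ⟨n, r, hr⟩ := hX.exists_representatives
  choose i π hπ using hr
  have hfin : ∀ i, Finite (supp 𝔸 (r i)) := fun i => hnom.finite_supp (r i)
  have hmem : ∀ (x : {x : X | Supports (FinPerm 𝔸) (S : Set 𝔸) x}) (a : supp 𝔸 (r (i x))),
      π x • (a : 𝔸) ∈ S := fun x a => by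
    refine supp_subset x.2 ?_
    have := smul_mem_supp a.2 (π x)
    rwa [hπ] at this
  -- An element is determined by its orbit representative and by the restriction, to the support of
  -- that representative, of a permutation leading to it. These restrictions take values in `S`, so
  -- there are finitely many codes.
  let f : {x : X | Supports (FinPerm 𝔸) (S : Set 𝔸) x} → Σ i, supp 𝔸 (r i) → S :=
    fun x => ⟨i x, fun a => ⟨π x • (a : 𝔸), hmem x a⟩⟩
  refine Set.finite_coe_iff.1 (Finite.of_injective f fun x y hxy => Subtype.ext ?_)
  have key : ∀ (j j' : Fin n) (σ σ' : FinPerm 𝔸)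
      (h : ∀ a : supp 𝔸 (r j), σ • (a : 𝔸) ∈ S) (h' : ∀ a : supp 𝔸 (r j'), σ' • (a : 𝔸) ∈ S),
      (⟨j, fun a : supp 𝔸 (r j) => (⟨σ • (a : 𝔸), h a⟩ : S)⟩ : Σ i, supp 𝔸 (r i) → S) =
        ⟨j', fun a => ⟨σ' • (a : 𝔸), h' a⟩⟩ → σ • r j = σ' • r j' := by
    intro j j' σ σ' h h' heq
    obtain rfl : j = j' := congrArg Sigma.fst heq
    refine (hnom.supports_supp (r j)).smul_eq_smul fun a ha => ?_
    exact congrArg Subtype.val (congrFun (eq_of_heq (Sigma.mk.inj heq).2) ⟨a, ha⟩)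
  have := key _ _ _ _ _ _ hxy
  rwa [hπ, hπ] at this

end Support

/-- The joint support of a tuple has at most `∑ i, k i` names, so every orbit meets the finite set
of tuples supported by one window of that size. -/
theorem NominalMonoid.OrbitFinite.pi {𝔸 : Type u} [Infinite 𝔸] {n : ℕ}
    {M : Fin n → NominalMonoid 𝔸} (hM : ∀ i, (M i).OrbitFinite) :
    (NominalMonoid.pi M).OrbitFinite := by
  classical
  choose k hk using fun i => (hM i).exists_ncard_supp_le
  let t : Fin (∑ i, k i) ↪ 𝔸 := Fin.valEmbedding.trans (Infinite.natEmbedding 𝔸)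
  let S : Finset 𝔸 := Finset.univ.map t
  let F := {x : NominalMonoid.pi M | ∀ i, Supports (FinPerm 𝔸) (S : Set 𝔸)
    ((show ∀ i, M i from x) i)}
  have hF : F.Finite := Set.Finite.pi' fun i => (hM i).finite_supports (M i).nominal S
  have : Finite F := hF
  refine isOrbitFinite_of_representatives (fun x : F => x.1) fun x => ?_
  let A : Finset 𝔸 := Finset.univ.biUnion fun i => ((M i).nominal.finite_supp (x i)).toFinset
  have hA : A.card ≤ ∑ i, k i := by
    refine Finset.card_biUnion_le.trans (Finset.sum_le_sum fun i _ => ?_)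
    rw [← Set.ncard_eq_toFinset_card _ ((M i).nominal.finite_supp (x i))]
    exact hk i (x i)
  obtain ⟨π, hπ⟩ := FinPerm.exists_smul_mem_range t A hA
  refine ⟨⟨π • x, fun i => ?_⟩, π⁻¹, inv_smul_smul π x⟩
  refine (supports_smul ((M i).nominal.supports_supp (x i)) π).mono ?_
  rintro _ ⟨a, ha, rfl⟩
  obtain ⟨j, hj⟩ := hπ a (Finset.mem_biUnion.2 ⟨i, Finset.mem_univ i, by simpa using ha⟩)
  exact Finset.mem_coe.2 (Finset.mem_map.2 ⟨j, Finset.mem_univ j, hj⟩)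

/-! ### Equivariant morphisms on words and the maps `ĥ` -/

section Reiterman

variable {𝔸 : Type u}

/-- An equivariant monoid morphism from a monoid morphism that commutes with the action. -/
def MonoidHom.toEquivariant {M N : Type*} [Monoid M] [Monoid N]
    [MulDistribMulAction (FinPerm 𝔸) M] [MulDistribMulAction (FinPerm 𝔸) N] (f : M →* N)
    (hf : ∀ (π : FinPerm 𝔸) x, f (π • x) = π • f x) : M →*[FinPerm 𝔸] N where
  toFun := f
  map_smul' := hf
  map_one' := map_one f
  map_mul' := map_mul f

theorem SupportBound.Bounds.supports [Infinite 𝔸] {s : SupportBound 𝔸 Sig} {X : Type u}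
    [MulAction (FinPerm 𝔸) X] {h : FreeMonoid Sig → X} (hs : s.Bounds h) (hX : IsNominal 𝔸 X)
    (w : FreeMonoid Sig) : Supports (FinPerm 𝔸) (s.toFun w : Set 𝔸) (h w) :=
  (hX.supports_supp _).mono (hs w)

section Words

variable {Sig : Type u} [MulAction (FinPerm 𝔸) Sig]

theorem FreeMonoid.smul_of (π : FinPerm 𝔸) (a : Sig) :
    π • FreeMonoid.of a = FreeMonoid.of (π • a) := rfl

theorem FreeMonoid.hom_smul {M : Type*} [Monoid M] [MulDistribMulAction (FinPerm 𝔸) M]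
    (f : FreeMonoid Sig →* M)
    (hf : ∀ (π : FinPerm 𝔸) a, f (.of (π • a)) = π • f (.of a)) (π : FinPerm 𝔸)
    (w : FreeMonoid Sig) : f (π • w) = π • f w := by
  induction w using FreeMonoid.inductionOn with
  | one => rw [smul_one, map_one, smul_one]
  | of a => rw [FreeMonoid.smul_of, hf]
  | mul v w hv hw => rw [smul_mul', map_mul, map_mul, smul_mul', hv, hw]

/-- The equivariant extension of an equivariant map on letters. -/
def FreeMonoid.equivariantLift {M : Type*} [Monoid M] [MulDistribMulAction (FinPerm 𝔸) M]
    (f : Sig → M) (hf : ∀ (π : FinPerm 𝔸) a, f (π • a) = π • f a) :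
    FreeMonoid Sig →*[FinPerm 𝔸] M :=
  (FreeMonoid.lift f).toEquivariant
    (FreeMonoid.hom_smul _ fun π a => by simp [hf])

theorem FreeMonoid.equivariantLift_of {M : Type*} [Monoid M] [MulDistribMulAction (FinPerm 𝔸) M]
    (f : Sig → M) (hf : ∀ (π : FinPerm 𝔸) a, f (π • a) = π • f a) (a : Sig) :
    FreeMonoid.equivariantLift f hf (.of a) = f a :=
  FreeMonoid.lift_eval_of f a

theorem IsNominal.freeMonoid (hS : IsNominal 𝔸 Sig) : IsNominal 𝔸 (FreeMonoid Sig) := by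
  classical
  intro w
  induction w using FreeMonoid.inductionOn with
  | one => exact ⟨∅, fun π _ => smul_one π⟩
  | of a =>
    obtain ⟨S, h⟩ := hS a
    exact ⟨S, fun π hπ => congrArg FreeMonoid.of (h π hπ)⟩
  | mul v w hv hw =>
    obtain ⟨S, hS⟩ := hv
    obtain ⟨T, hT⟩ := hw
    refine ⟨S ∪ T, fun π hπ => ?_⟩
    rw [smul_mul', hS π fun a ha => hπ (by simp [Finset.mem_coe.1 ha]),
      hT π fun a ha => hπ (by simp [Finset.mem_coe.1 ha])]

/-- The quotient of the free monoid over a nominal alphabet, as a nominal monoid. -/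
def EquivariantCon.toNominalMonoid (hS : IsNominal 𝔸 Sig) (c : EquivariantCon 𝔸 Sig) :
    NominalMonoid 𝔸 where
  carrier := c.Quot
  nominal x := by
    obtain ⟨w, rfl⟩ := c.proj_surjective x
    obtain ⟨S, h⟩ := hS.freeMonoid w
    exact ⟨S, supports_map (f := c.proj) (fun π w => (c.smul_proj π w).symm) h⟩

/-- By compatibility both sides depend only on the component at `ker g`. That component is the class
of some word, where the claim is `hf`. -/
theorem ProWord.hat_comp {s : SupportBound 𝔸 Sig} {M N : NominalMonoid 𝔸}
    (hM : M.OrbitFinite) (hN : N.OrbitFinite) {g : FreeMonoid Sig →*[FinPerm 𝔸] M}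
    {h : FreeMonoid Sig →*[FinPerm 𝔸] N} (hg : s.Bounds g) (hh : s.Bounds h) (f : M → N)
    (hf : ∀ w, f (g w) = h w) (x : ProWord s) : f (x.hat hM g hg) = x.hat hN h hh := by
  have hle : (EquivariantCon.ker g).con ≤ (EquivariantCon.ker h).con := by
    intro v w hvw
    change h v = h w
    rw [← hf, ← hf, show g v = g w from hvw]
  have hx := x.compatible (BoundedQuotient.coimage hM g hg) (BoundedQuotient.coimage hN h hh) hle
  unfold ProWord.hat
  rw [← hx]
  obtain ⟨w, hw⟩ := (EquivariantCon.ker g).proj_surjective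
    (x.val (BoundedQuotient.coimage hM g hg))
  rw [← hw]
  exact hf w

/-- An equivariant family of choices on a strong nominal set: if each `x` admits a related
element with support contained in that of `x`, then these can be chosen equivariantly. -/
theorem IsStrong.exists_equivariant [Infinite 𝔸] (hstr : IsStrong 𝔸 Sig) {X : Type u}
    [MulAction (FinPerm 𝔸) X] (hX : IsNominal 𝔸 X) (R : Sig → X → Prop)
    (hR : ∀ (π : FinPerm 𝔸) a x, R a x → R (π • a) (π • x))
    (hex : ∀ a, ∃ x, R a x ∧ supp 𝔸 x ⊆ supp 𝔸 a) :
    ∃ f : Sig → X, (∀ (π : FinPerm 𝔸) a, f (π • a) = π • f a) ∧ ∀ a, R a (f a) := by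
  choose x hx hsupp using hex
  let r : Sig → Sig := fun a => (⟦a⟧ : orbitRel.Quotient (FinPerm 𝔸) Sig).out
  have hr : ∀ a, ∃ π : FinPerm 𝔸, π • r a = a := fun a =>
    (orbitRel (FinPerm 𝔸) Sig).symm (Quotient.mk_out (s := orbitRel (FinPerm 𝔸) Sig) a)
  have hr' : ∀ (π : FinPerm 𝔸) a, r (π • a) = r a := fun π a =>
    congrArg Quotient.out (Quotient.sound ⟨π, rfl⟩ :
      (⟦π • a⟧ : orbitRel.Quotient (FinPerm 𝔸) Sig) = ⟦a⟧)
  choose σ hσ using hr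
  -- Strongness enters here: `π • a = τ • a` forces `π` and `τ` to agree on `supp a`, hence on the
  -- support of the chosen `x a`. So translating the choice made at the orbit representative is well
  -- defined.
  have key : ∀ (π τ : FinPerm 𝔸) a, π • a = τ • a → π • x a = τ • x a := by
    intro π τ a h
    have h1 : ∀ b ∈ supp 𝔸 a, (τ⁻¹ * π) • b = b :=
      (hstr a (τ⁻¹ * π)).1 (by rw [mul_smul, h, inv_smul_smul])
    refine (hX.supports_supp (x a)).smul_eq_smul fun b hb => ?_
    rw [← inv_smul_eq_iff, ← mul_smul]
    exact h1 b (hsupp a hb)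
  refine ⟨fun a => σ a • x (r a), fun π a => ?_, fun a => ?_⟩
  · dsimp only
    rw [← mul_smul, hr' π a]
    refine key _ _ _ ?_
    rw [mul_smul, hσ, ← hr' π a, hσ]
  · have := hR (σ a) _ _ (hx (r a))
    rwa [hσ] at this

end Words

/-- The evaluation at an index, as an equivariant monoid morphism. -/
def NominalMonoid.evalHom {n : ℕ} (M : Fin n → NominalMonoid 𝔸) (i : Fin n) :
    NominalMonoid.pi M →*[FinPerm 𝔸] M i :=
  (Pi.evalMonoidHom (fun i => (M i : Type u)) i).toEquivariant fun _ _ => rfl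

/-- The inclusion of a nominal submonoid, as an equivariant monoid morphism. -/
def NominalMonoid.NomSubmonoid.inclusion {M : NominalMonoid 𝔸} (N : M.NomSubmonoid) :
    N.toNominalMonoid →*[FinPerm 𝔸] M :=
  MonoidHom.toEquivariant (M := N.toNominalMonoid) N.toSubmonoid.subtype fun _ _ => rfl

/-! ### Soundness: closure properties of satisfaction -/

namespace ExplicitProequation

variable {E : ExplicitProequation 𝔸}

theorem SatisfiedBy.pi {n : ℕ} {M : Fin n → NominalMonoid 𝔸} {hM : ∀ i, (M i).OrbitFinite}
    (hE : ∀ i, E.SatisfiedBy (M i) (hM i)) (hpi : (NominalMonoid.pi M).OrbitFinite) :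
    E.SatisfiedBy (NominalMonoid.pi M) hpi := by
  intro h hs
  funext i
  let g : FreeMonoid E.Sig →*[FinPerm 𝔸] M i :=
    MulDistribMulActionHom.comp (NominalMonoid.evalHom M i) h
  have hg : E.s.Bounds g := fun w =>
    (supp_map_subset (f := NominalMonoid.evalHom M i) (map_smul _) (h w)).trans (hs w)
  have key := fun x => ProWord.hat_comp hpi (hM i) hs hg (NominalMonoid.evalHom M i)
    (fun _ => rfl) x
  exact (key E.lhs).trans ((hE i g hg).trans (key E.rhs).symm)

theorem SatisfiedBy.of_injective {M N : NominalMonoid 𝔸} {hM : M.OrbitFinite}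
    (hE : E.SatisfiedBy M hM) (hN : N.OrbitFinite) (m : N →*[FinPerm 𝔸] M)
    (hm : Function.Injective m) : E.SatisfiedBy N hN := by
  intro h hs
  let g : FreeMonoid E.Sig →*[FinPerm 𝔸] M := MulDistribMulActionHom.comp m h
  have hg : E.s.Bounds g := fun w => (supp_map_subset (map_smul m) (h w)).trans (hs w)
  have key := fun x => ProWord.hat_comp hN hM hs hg m (fun _ => rfl) x
  exact hm ((key E.lhs).trans ((hE g hg).trans (key E.rhs).symm))

theorem SatisfiedBy.quotient [Infinite 𝔸] {M N : NominalMonoid 𝔸} {hM : M.OrbitFinite}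
    (hE : E.SatisfiedBy M hM) (hN : N.OrbitFinite) {e : M →*[FinPerm 𝔸] N}
    (he : IsMSRQuotient e) : E.SatisfiedBy N hN := by
  obtain ⟨-, M', hsurj, hsupp⟩ := he
  intro h hs
  obtain ⟨f, hf, hfR⟩ := E.strong.exists_equivariant M.nominal
    (fun a x => x ∈ M'.toSubmonoid ∧ e x = h (.of a))
    (fun π a x hx => ⟨M'.smul_mem' π hx.1, by
      rw [map_smul, hx.2, ← map_smul, FreeMonoid.smul_of]⟩)
    (fun a => by
      obtain ⟨x, hx, hxe⟩ := hsurj (h (.of a))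
      -- On `M'` the preimage has the same support as `h(a)`, and that lies in `supp a` by
      -- equivariance.
      refine ⟨x, ⟨hx, hxe⟩, ?_⟩
      rw [← hsupp x hx, hxe]
      exact supp_map_subset (f := fun a => h (.of a)) (fun π a => by
        rw [← FreeMonoid.smul_of, map_smul]) a)
  let g : FreeMonoid E.Sig →*[FinPerm 𝔸] M := FreeMonoid.equivariantLift f hf
  have hgM' : ∀ w, g w ∈ M'.toSubmonoid ∧ e (g w) = h w := by
    intro w
    induction w using FreeMonoid.inductionOn with
    | one => rw [map_one, map_one, map_one]; exact ⟨one_mem _, rfl⟩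
    | of a => rw [FreeMonoid.equivariantLift_of]; exact hfR a
    | mul v w hv hw =>
      rw [map_mul, map_mul, map_mul, hv.2, hw.2]; exact ⟨mul_mem hv.1 hw.1, rfl⟩
  -- The lift stays in `M'`, a submonoid, so support preservation applies to all words and not only
  -- to letters.
  have hg : E.s.Bounds g := fun w => by
    rw [← hsupp _ (hgM' w).1, (hgM' w).2]
    exact hs w
  have key := fun x => ProWord.hat_comp hM hN hg hs e (fun w => (hgM' w).2) x
  rw [← key, ← key, hE g hg]

end ExplicitProequation

theorem IsPresentableByExplicitProequations.isMSRPseudovariety [Infinite 𝔸]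
    {V : Set (NominalMonoid 𝔸)} (hV : IsPresentableByExplicitProequations V) :
    IsMSRPseudovariety V := by
  obtain ⟨T, -, rfl⟩ := hV
  refine ⟨fun M hM => hM.1, fun n M hM => ?_, fun M hM N => ?_, fun M hM N e he => ?_⟩
  · choose hfin hsat using hM
    exact ⟨.pi hfin, fun E hE => .pi (fun i => hsat i E hE) _⟩
  · obtain ⟨hfin, hsat⟩ := hM
    have hinj : Function.Injective N.inclusion := Subtype.val_injective
    exact ⟨hfin.of_injective (map_smul N.inclusion) hinj,
      fun E hE => (hsat E hE).of_injective _ N.inclusion hinj⟩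
  · obtain ⟨hfin, hsat⟩ := hM
    exact ⟨hfin.of_surjective (map_smul e) he.1, fun E hE => (hsat E hE).quotient _ he⟩

/-! ### Isomorphic copies and codirectedness in a pseudovariety -/

namespace IsMSRPseudovariety

variable {V : Set (NominalMonoid 𝔸)}

/-- The inverse of the isomorphism onto the image preserves supports, so it is an MSR quotient with
`M'` the whole image. In particular, `V` is closed under isomorphism. -/
theorem mem_of_injective (hV : IsMSRPseudovariety V) {M N : NominalMonoid 𝔸} (hM : M ∈ V)
    (m : N →*[FinPerm 𝔸] M) (hm : Function.Injective m) : N ∈ V := by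
  let R : M.NomSubmonoid :=
    { MonoidHom.mrange m.toMonoidHom with
      smul_mem' := by
        rintro π _ ⟨y, rfl⟩
        exact ⟨π • y, map_smul m π y⟩ }
  let f : N ≃* R.toSubmonoid := MulEquiv.ofBijective m.toMonoidHom.mrangeRestrict
    ⟨fun x y h => hm (congrArg Subtype.val h), MonoidHom.mrangeRestrict_surjective _⟩
  have hf : ∀ (π : FinPerm 𝔸) (x : R.toNominalMonoid), f.symm (π • x) = π • f.symm x := by
    intro π x
    obtain ⟨y, rfl⟩ := f.surjective x
    rw [f.symm_apply_apply]
    exact f.symm_apply_eq.2 (Subtype.ext (map_smul m π y).symm)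
  let e : R.toNominalMonoid →*[FinPerm 𝔸] N :=
    MonoidHom.toEquivariant (M := R.toNominalMonoid) f.symm.toMonoidHom hf
  refine hV.quotient_mem _ (hV.sub_mem M hM R) N e ⟨f.symm.surjective, ⟨⊤, fun _ _ _ => trivial⟩,
    fun y => ?_, fun x _ => supp_map_of_injective hf f.symm.injective x⟩
  obtain ⟨x, hx⟩ := f.symm.surjective y
  exact ⟨x, trivial, hx⟩

variable {Sig : Type u} [MulAction (FinPerm 𝔸) Sig]

theorem ker_mem (hV : IsMSRPseudovariety V) (hS : IsNominal 𝔸 Sig) {M : NominalMonoid 𝔸}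
    (hM : M ∈ V) (h : FreeMonoid Sig →*[FinPerm 𝔸] M) :
    (EquivariantCon.ker h).toNominalMonoid hS ∈ V :=
  hV.mem_of_injective hM
    (MonoidHom.toEquivariant (M := (EquivariantCon.ker h).Quot) (EquivariantCon.kerLift h)
      (EquivariantCon.kerLift_smul h))
    (EquivariantCon.kerLift_injective h)

/-- The `s`-bounded quotients that lie in a pseudovariety are codirected. -/
theorem exists_common_refinement [Infinite 𝔸] (hV : IsMSRPseudovariety V)
    (hS : IsNominal 𝔸 Sig) (s : SupportBound 𝔸 Sig) {n : ℕ} (q : Fin n → BoundedQuotient s)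
    (hq : ∀ i, (q i).toNominalMonoid hS ∈ V) :
    ∃ r : BoundedQuotient s, r.toNominalMonoid hS ∈ V ∧ ∀ i, r.con ≤ (q i).con := by
  have hpi := hV.prod_mem n _ hq
  -- The refinement is the kernel of the tupled projections; `s(w)` supports every component, so it
  -- bounds the tuple too.
  let h : FreeMonoid Sig →*[FinPerm 𝔸] NominalMonoid.pi fun i => (q i).toNominalMonoid hS :=
    MonoidHom.toEquivariant (N := ∀ i, (q i).Quot) (MonoidHom.pi fun i => (q i).proj)
      fun _ _ => rfl
  have hs : s.Bounds h := by
    intro w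
    refine supp_subset fun π hπ => funext fun i => ?_
    exact (q i).bounded.supports ((q i).toNominalMonoid hS).nominal w π hπ
  refine ⟨BoundedQuotient.coimage (hV.orbitFinite _ hpi) h hs, hV.ker_mem hS hpi h,
    fun i v w hvw => ?_⟩
  exact (q i).proj_eq.1 (congrFun (show h v = h w from hvw) i)

end IsMSRPseudovariety

/-! ### Compactness and separation by pro-words -/

section Limit

theorem Ultrafilter.exists_eventually_eq {ι α : Type*} (U : Ultrafilter ι) {F : Set α}
    (hF : F.Finite) (f : ι → α) (hf : ∀ i, f i ∈ F) : ∃ a ∈ F, ∀ᶠ i in U, f i = a :=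
  (Ultrafilter.eventually_exists_mem_iff hF).1
    (Filter.Eventually.of_forall fun i => ⟨f i, hf i, rfl⟩)

variable {Sig : Type u} [MulAction (FinPerm 𝔸) Sig]

/-- Words with supports inside a fixed finite set of names converge along every ultrafilter. -/
theorem ProWord.exists_limit [Infinite 𝔸] (hS : IsNominal 𝔸 Sig) {s : SupportBound 𝔸 Sig}
    {ι : Type*} (U : Ultrafilter ι) (v : ι → FreeMonoid Sig) (S : Finset 𝔸) (A : ι → Finset 𝔸)
    (hAS : ∀ i, A i ⊆ S) (hcard : ∀ k, (∀ w, (s.toFun w).card ≤ k) → ∀ i, (A i).card ≤ k)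
    (hsupp : ∀ i (q : BoundedQuotient s),
      Supports (FinPerm 𝔸) (A i : Set 𝔸) (q.proj (v i))) :
    ∃ x : ProWord s, ∀ q : BoundedQuotient s, ∀ᶠ i in U, q.proj (v i) = x.val q := by
  have hlim : ∀ q : BoundedQuotient s, ∃ a : q.Quot, ∀ᶠ i in U, q.proj (v i) = a := by
    intro q
    obtain ⟨a, -, ha⟩ := U.exists_eventually_eq
      (q.orbitFinite.finite_supports (q.toNominalMonoid hS).nominal S) (fun i => q.proj (v i))
      (fun i => (hsupp i q).mono (hAS i))
    exact ⟨a, ha⟩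
  choose a ha using hlim
  refine ⟨⟨a, fun q r h => ?_, fun k hk => ?_⟩, ha⟩
  · obtain ⟨i, hq, hr⟩ := ((ha q).and (ha r)).exists
    rw [← hq, ← hr]
    rfl
  -- The window `S` may have more than `k` names. The sets `A i` range over its finitely many
  -- subsets, so one of them, `B`, occurs along the ultrafilter and is a common support of the right
  -- size.
  · obtain ⟨B, -, hB⟩ := U.exists_eventually_eq S.powerset.finite_toSet A
      (fun i => Finset.mem_coe.2 (Finset.mem_powerset.2 (hAS i)))
    refine ⟨B, ?_, fun q => ?_⟩
    · obtain ⟨i, rfl⟩ := hB.exists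
      exact hcard k hk i
    · obtain ⟨i, hi, rfl⟩ := ((ha q).and hB).exists
      rw [← hi]
      exact hsupp i q

/-- A bounded quotient that is not refined by any bounded quotient in a pseudovariety `V` is
separated from these by a pair of pro-orbit-finite words. -/
theorem IsMSRPseudovariety.exists_separating [Infinite 𝔸] {V : Set (NominalMonoid 𝔸)}
    (hV : IsMSRPseudovariety V) (hS : IsNominal 𝔸 Sig) {s : SupportBound 𝔸 Sig}
    (e : BoundedQuotient s)
    (he : ∀ q : BoundedQuotient s, q.toNominalMonoid hS ∈ V → ¬ q.con ≤ e.con) :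
    ∃ x y : ProWord s,
      (∀ q : BoundedQuotient s, q.toNominalMonoid hS ∈ V → x.val q = y.val q) ∧
        x.val e ≠ y.val e := by
  classical
  let ι := {q : BoundedQuotient s // q.toNominalMonoid hS ∈ V}
  -- The empty family suffices: the empty product lies in `V`.
  have : Nonempty ι := by
    obtain ⟨r, hr, -⟩ := hV.exists_common_refinement hS s (n := 0) (fun i => i.elim0)
      (fun i => i.elim0)
    exact ⟨r, hr⟩
  -- The filter of refinements: along it, the index eventually refines any given quotient in `V`.
  let F : Filter ι := ⨅ q : ι, Filter.principal {r : ι | r.1.con ≤ q.1.con}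
  have hF : F.NeBot := by
    refine Filter.iInf_neBot_of_directed (fun p q => ?_) fun q =>
      Filter.principal_neBot_iff.2 ⟨q, le_refl q.1.con⟩
    obtain ⟨r, hr, hle⟩ := hV.exists_common_refinement hS s ![p.1, q.1] (fun i => by
      fin_cases i
      · exact p.2
      · exact q.2)
    refine ⟨⟨r, hr⟩, ?_, ?_⟩
    · exact Filter.principal_mono.2 fun r' hr' => le_trans hr' (hle 0)
    · exact Filter.principal_mono.2 fun r' hr' => le_trans hr' (hle 1)
  let U : Ultrafilter ι := Ultrafilter.of F
  have hU : ∀ q : ι, ∀ᶠ r : ι in U, r.1.con ≤ q.1.con := fun q =>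
    Ultrafilter.of_le F (Filter.mem_iInf_of_mem q (Filter.mem_principal_self _))
  have hvw : ∀ q : ι, ∃ v w, q.1.con v w ∧ ¬ e.con v w := by
    intro q
    by_contra! h
    exact he q.1 q.2 fun {v w} => h v w
  choose v w hq hne using hvw
  obtain ⟨k, hk⟩ := s.bounded
  -- One permutation must move both words of a pair, since only a common renaming keeps them
  -- separated by `e`; hence a window for two sets of at most `k` names.
  let t : Fin (k + k) ↪ 𝔸 := Fin.valEmbedding.trans (Infinite.natEmbedding 𝔸)
  have hπ : ∀ q : ι, ∃ π : FinPerm 𝔸, ∀ a ∈ s.toFun (v q) ∪ s.toFun (w q),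
      π • a ∈ Set.range t := fun q =>
    FinPerm.exists_smul_mem_range t _
      ((Finset.card_union_le _ _).trans (Nat.add_le_add (hk _) (hk _)))
  choose π hπ using hπ
  have hlim : ∀ u : ι → FreeMonoid Sig,
      (∀ q, s.toFun (u q) ⊆ s.toFun (v q) ∪ s.toFun (w q)) →
      ∃ x : ProWord s, ∀ p : BoundedQuotient s, ∀ᶠ q in U, p.proj (π q • u q) = x.val p := by
    intro u hu
    refine ProWord.exists_limit hS U _ (Finset.univ.map t)
      (fun q => (s.toFun (u q)).image (π q • ·)) (fun q => ?_) (fun k hk q => ?_)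
      fun q p => ?_
    · refine Finset.image_subset_iff.2 fun a ha => ?_
      obtain ⟨j, hj⟩ := hπ q a (hu q ha)
      exact Finset.mem_map.2 ⟨j, Finset.mem_univ j, hj⟩
    · exact Finset.card_image_le.trans (hk _)
    · rw [Finset.coe_image, ← p.smul_proj]
      exact supports_smul (p.bounded.supports (p.toNominalMonoid hS).nominal _) _
  obtain ⟨x, hx⟩ := hlim v fun q => Finset.subset_union_left
  obtain ⟨y, hy⟩ := hlim w fun q => Finset.subset_union_right
  refine ⟨x, y, fun p hp => ?_, fun hxy => ?_⟩
  -- An index `q` refining `p` identifies its two words, hence so does `p`, also after renaming.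
  · obtain ⟨q, hle, hxq, hyq⟩ := ((hU ⟨p, hp⟩).and ((hx p).and (hy p))).exists
    rw [← hxq, ← hyq, p.proj_eq]
    exact p.smul_con _ (hle (hq q))
  · obtain ⟨q, hxq, hyq⟩ := ((hx e).and (hy e)).exists
    rw [← hxq, ← hyq, ← e.smul_proj, ← e.smul_proj] at hxy
    exact hne q (e.proj_eq.1 (smul_left_cancel _ hxy))

end Limit

/-! ### Tuple alphabets -/

/-- The strong nominal set of `n` copies of the set of `k`-tuples of distinct names. -/
def TupleAlphabet (𝔸 : Type u) (n k : ℕ) : Type u := Fin n × (Fin k ↪ 𝔸)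

namespace TupleAlphabet

variable {n k : ℕ}

instance : MulAction (FinPerm 𝔸) (TupleAlphabet 𝔸 n k) where
  smul π a := (a.1, π • a.2)
  one_smul a := Prod.ext rfl (one_smul _ a.2)
  mul_smul π σ a := Prod.ext rfl (mul_smul π σ a.2)

theorem smul_eq_self_iff (π : FinPerm 𝔸) (a : TupleAlphabet 𝔸 n k) :
    π • a = a ↔ ∀ j, π • a.2 j = a.2 j := by
  refine ⟨fun h j => DFunLike.congr_fun (congrArg Prod.snd h) j, fun h => ?_⟩
  exact Prod.ext rfl (Function.Embedding.ext h)

theorem supports_map_univ (a : TupleAlphabet 𝔸 n k) :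
    Supports (FinPerm 𝔸) ((Finset.univ.map a.2 : Finset 𝔸) : Set 𝔸) a := fun π hπ =>
  (smul_eq_self_iff π a).2 fun j => hπ (by simp)

theorem isNominal : IsNominal 𝔸 (TupleAlphabet 𝔸 n k) := fun a => ⟨_, supports_map_univ a⟩

theorem supp_eq [Infinite 𝔸] (a : TupleAlphabet 𝔸 n k) : supp 𝔸 a = Set.range a.2 := by
  rw [supp_eq_of_supports_of_forall_fix (supports_map_univ a) fun π hπ b hb => ?_]
  · simp
  · obtain ⟨j, -, rfl⟩ := Finset.mem_map.1 hb
    exact (smul_eq_self_iff π a).1 hπ j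

theorem isStrong [Infinite 𝔸] : IsStrong 𝔸 (TupleAlphabet 𝔸 n k) := fun a π => by
  rw [smul_eq_self_iff, supp_eq, Set.forall_mem_range]

theorem isOrbitFinite [Infinite 𝔸] : IsOrbitFinite 𝔸 (TupleAlphabet 𝔸 n k) := by
  let t : Fin k ↪ 𝔸 := Fin.valEmbedding.trans (Infinite.natEmbedding 𝔸)
  refine isOrbitFinite_of_representatives (fun i : Fin n => ((i, t) : TupleAlphabet 𝔸 n k))
    fun a => ⟨a.1, ?_⟩
  obtain ⟨π, hπ⟩ := FinPerm.exists_smul_embedding_eq t a.2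
  exact ⟨π, Prod.ext rfl hπ⟩

/-- Every orbit-finite nominal set is an equivariant image of a set of tuples. -/
theorem exists_surjective [Infinite 𝔸] {X : Type u} [MulAction (FinPerm 𝔸) X]
    (hX : IsNominal 𝔸 X) (hfin : IsOrbitFinite 𝔸 X) :
    ∃ (n k : ℕ) (f : TupleAlphabet 𝔸 n k → X),
      (∀ (π : FinPerm 𝔸) a, f (π • a) = π • f a) ∧ Function.Surjective f := by
  obtain ⟨n, r, hr⟩ := hfin.exists_representatives
  obtain ⟨k, hk⟩ := hfin.exists_ncard_supp_le
  let t : Fin k ↪ 𝔸 := Fin.valEmbedding.trans (Infinite.natEmbedding 𝔸)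
  -- Renaming each representative into the window `t` makes it an admissible image of the letter
  -- `(i, t)`, whose support is exactly the range of `t`.
  have hσ : ∀ i, ∃ σ : FinPerm 𝔸, Supports (FinPerm 𝔸) (Set.range t) (σ • r i) := by
    intro i
    obtain ⟨σ, hσ⟩ := FinPerm.exists_smul_mem_range t (hX.finite_supp (r i)).toFinset
      (by rw [← Set.ncard_eq_toFinset_card _ (hX.finite_supp (r i))]; exact hk _)
    refine ⟨σ, (supports_smul (hX.supports_supp (r i)) σ).mono ?_⟩
    rintro _ ⟨a, ha, rfl⟩
    exact hσ a (by simpa using ha)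
  choose σ hσ using hσ
  have ht : ∀ x : X, Supports (FinPerm 𝔸) (Set.range t) x → supp 𝔸 x ⊆ Set.range t := by
    intro x hx
    have := supp_subset (S := Finset.univ.map t) (x := x) (by simpa using hx)
    simpa using this
  obtain ⟨f, hf, hfR⟩ := isStrong.exists_equivariant hX
    (fun (a : TupleAlphabet 𝔸 n k) x => ∃ π : FinPerm 𝔸, π • t = a.2 ∧ x = π • σ a.1 • r a.1)
    (by
      rintro π a _ ⟨τ, hτ, rfl⟩
      exact ⟨π * τ, (mul_smul π τ t).trans (congrArg (π • ·) hτ), (mul_smul π τ _).symm⟩)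
    (fun a => by
      obtain ⟨π, hπ⟩ := FinPerm.exists_smul_embedding_eq t a.2
      refine ⟨_, ⟨π, hπ, rfl⟩, ?_⟩
      rw [supp_eq, supp_smul, ← hπ]
      rintro _ ⟨b, hb, rfl⟩
      obtain ⟨j, rfl⟩ := ht _ (hσ a.1) hb
      exact ⟨j, rfl⟩)
  refine ⟨n, k, f, hf, fun x => ?_⟩
  obtain ⟨i, π, rfl⟩ := hr x
  -- The letter `(i, t)` corresponds to `σ i • r i`, so `σ i` has to be undone before `π` is
  -- applied.
  refine ⟨(i, (π * (σ i)⁻¹) • t), ?_⟩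
  obtain ⟨τ, hτ, h⟩ := hfR (i, (π * (σ i)⁻¹) • t)
  rw [h]
  have : τ • σ i • r i = (π * (σ i)⁻¹) • σ i • r i := by
    refine (hσ i).smul_eq_smul ?_
    rintro _ ⟨j, rfl⟩
    exact DFunLike.congr_fun hτ j
  rw [mul_smul, inv_smul_smul] at this
  exact this

/-- The explicit proequation between two pro-orbit-finite words over a set of tuples. -/
def proequation [Infinite 𝔸] {s : SupportBound 𝔸 (TupleAlphabet 𝔸 n k)} (x y : ProWord s) :
    ExplicitProequation 𝔸 where
  Sig := TupleAlphabet 𝔸 n k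
  nominal := isNominal
  orbitFinite := isOrbitFinite
  strong := isStrong
  s := s
  lhs := x
  rhs := y

end TupleAlphabet

/-! ### Completeness -/

/-- The support bound that makes a morphism preserve supports. -/
noncomputable def SupportBound.ofMorphism {Sig : Type u} {M : NominalMonoid 𝔸}
    (hM : M.OrbitFinite) (g : FreeMonoid Sig → M) : SupportBound 𝔸 Sig where
  toFun w := (M.nominal.finite_supp (g w)).toFinset
  bounded := by
    obtain ⟨k, hk⟩ := hM.exists_ncard_supp_le
    refine ⟨k, fun w => ?_⟩
    rw [← Set.ncard_eq_toFinset_card _ (M.nominal.finite_supp (g w))]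
    exact hk _

theorem SupportBound.coe_ofMorphism {Sig : Type u} {M : NominalMonoid 𝔸}
    (hM : M.OrbitFinite) (g : FreeMonoid Sig → M) (w : FreeMonoid Sig) :
    ((SupportBound.ofMorphism hM g).toFun w : Set 𝔸) = supp 𝔸 (g w) :=
  Set.Finite.coe_toFinset _

/-- If a bounded quotient in `V` refines a surjective morphism with respect to the support bound
given by that morphism, then the codomain of the morphism lies in `V`. -/
theorem IsMSRPseudovariety.mem_of_refinement [Infinite 𝔸] {V : Set (NominalMonoid 𝔸)}
    (hV : IsMSRPseudovariety V) {Sig : Type u} [MulAction (FinPerm 𝔸) Sig]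
    (hS : IsNominal 𝔸 Sig) {M : NominalMonoid 𝔸} (hM : M.OrbitFinite)
    (g : FreeMonoid Sig →*[FinPerm 𝔸] M) (hg : Function.Surjective g)
    (q : BoundedQuotient (SupportBound.ofMorphism hM g)) (hq : q.toNominalMonoid hS ∈ V)
    (hle : q.con ≤ (EquivariantCon.ker g).con) : M ∈ V := by
  let m : q.Quot →* M := Con.lift q.con g.toMonoidHom hle
  have hm : ∀ w, m (q.proj w) = g w := fun w => rfl
  have hequiv : ∀ (π : FinPerm 𝔸) x, m (π • x) = π • m x := by
    intro π x
    obtain ⟨w, rfl⟩ := q.proj_surjective x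
    rw [q.smul_proj, hm, hm, map_smul]
  have hsurj : Function.Surjective m := fun y => by
    obtain ⟨w, rfl⟩ := hg y
    exact ⟨q.proj w, hm w⟩
  refine hV.quotient_mem _ hq M (MonoidHom.toEquivariant (M := q.toNominalMonoid hS) m hequiv)
    ⟨hsurj, ⟨⊤, fun _ _ _ => trivial⟩, fun y => ?_, fun x _ => ?_⟩
  · obtain ⟨x, hx⟩ := hsurj y
    exact ⟨x, trivial, hx⟩
  -- The reverse inclusion is `s`-boundedness of `q`: the class of `w` has support inside `s(w)`,
  -- which is `supp g(w)` by the choice of `s`. Hence `M'` can be all of `q.Quot`.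
  · refine (supp_map_subset (X := q.Quot) (f := m) hequiv x).antisymm ?_
    obtain ⟨w, rfl⟩ := q.proj_surjective x
    refine (q.bounded w).trans ?_
    rw [SupportBound.coe_ofMorphism]
    exact subset_rfl

theorem IsMSRPseudovariety.isPresentableByExplicitProequations [Infinite 𝔸]
    {V : Set (NominalMonoid 𝔸)} (hV : IsMSRPseudovariety V) :
    IsPresentableByExplicitProequations V := by
  -- Restricting to tuple alphabets indexes the candidate proequations by a type in `Type u`, which
  -- gives smallness.
  let p : (Σ (n k : ℕ) (s : SupportBound 𝔸 (TupleAlphabet 𝔸 n k)), ProWord s × ProWord s) →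
      ExplicitProequation 𝔸 := fun i => TupleAlphabet.proequation i.2.2.2.1 i.2.2.2.2
  let T : Set (ExplicitProequation 𝔸) :=
    {E ∈ Set.range p | ∀ M (hM : M ∈ V), E.SatisfiedBy M (hV.orbitFinite M hM)}
  refine ⟨T, small_subset (s := Set.range p) (Set.sep_subset _ _), Set.Subset.antisymm
    (fun M hM => ⟨hV.orbitFinite M hM, fun E hE => hE.2 M hM⟩) ?_⟩
  rintro M ⟨hM, hsat⟩
  obtain ⟨n, k, f, hf, hfs⟩ := TupleAlphabet.exists_surjective M.nominal hM
  let g := FreeMonoid.equivariantLift f hf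
  have hg : Function.Surjective g := fun x => by
    obtain ⟨a, rfl⟩ := hfs x
    exact ⟨.of a, FreeMonoid.equivariantLift_of f hf a⟩
  let s := SupportBound.ofMorphism hM g
  have hs : s.Bounds g := fun w => (SupportBound.coe_ofMorphism hM g w).symm.subset
  by_contra hMV
  obtain ⟨x, y, hxy, hne⟩ := hV.exists_separating TupleAlphabet.isNominal
    (BoundedQuotient.coimage hM g hs) fun q hq hle =>
      hMV (hV.mem_of_refinement TupleAlphabet.isNominal hM g hg q hq hle)
  have hT : TupleAlphabet.proequation x y ∈ T := by
    refine ⟨⟨⟨n, k, s, x, y⟩, rfl⟩, fun N hN h hh => ?_⟩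
    -- `ĥ` reads a pro-word only at the coimage of `h`, which lies in `V`, where `x` and `y` agree.
    exact congrArg (EquivariantCon.kerLift h)
      (hxy (BoundedQuotient.coimage (hV.orbitFinite N hN) h hh)
        (hV.ker_mem TupleAlphabet.isNominal hN h))
  exact hne (EquivariantCon.kerLift_injective g (hsat _ hT g hs))

end Reiterman

theorem mainTheorem6 {𝔸 : Type u} [Countable 𝔸] [Infinite 𝔸]
    (V : Set (NominalMonoid 𝔸)) (hV : ∀ M ∈ V, M.OrbitFinite) :
    IsMSRPseudovariety V ↔ IsPresentableByExplicitProequations V :=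
  ⟨fun h => h.isPresentableByExplicitProequations, fun h => h.isMSRPseudovariety⟩
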